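/- Let $D$ be a finite set of size $n$, let $R$ be a set, let $\mathcal F$ be a finite family of functions $D\to R$, and let $\mathcal P:\mathcal F\to\{0,1\}$ be a property that takes both values. Let $S\subseteq D$ and $d\ge 0$, and suppose that $\mathcal P$ is $(d,S)$-independent: for all $z_1,\dots,z_d\in D$ (repetitions allowed) and $f$ uniformly distributed on $\mathcal F$, the tuple $(f(z_j))_{z_j\notin S}$ is independent of the tuple consisting of $(f(z_j))_{z_j\in S}$ and $\mathcal P(f)$. Let $\Delta$ be a permutation-independent distribution of maps $X$ from $\{1,\dots,N\}$ onto $D$ (for instance with $N=n$), that is, $X$ and $\sigma\circ X$ have the same probability for every permutation $\sigma$ of $D$. Let $\epsilon>0$, and let $A$ be a quantum query algorithm in the random-input model, that is, with access to $X$ and $f$ only through the oracle $|i,a,b,c\rangle\mapsto|i,a+X(i),b+f(X(i)),c\rangle$, where $+$ is a reversible addition on the answer registers. Suppose that for every $f\in\mathcal F$, with $X\sim\Delta$, the algorithm outputs $\mathcal P(f)$ with probability at least $\frac12+\epsilon$. Then the number of queries made by $A$ is at least $$\min\left\{\frac{d+1}{2},\ C_\epsilon\sqrt{\frac{n}{|S|}}\right\},$$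 where $C_\epsilon>0$ is a constant depending only on $\epsilon$, and where the minimum is read as $\frac{d+1}{2}$ if $S=\emptyset$. -/

import Mathlib

namespace RandomInput

/-- `U` and `V` are independent random variables on the finite sample space `Ω` carrying the
uniform distribution (every `σ`-algebra is discrete). -/
def UniformIndep {Ω α β : Type*} (U : Ω → α) (V : Ω → β) : Prop :=
  @ProbabilityTheory.IndepFun Ω α β ⊤ ⊤ ⊤ U V (@ProbabilityTheory.uniformOn Ω ⊤ Set.univ)

/-- A property `P` of a family `F` of functions `D → R` is `(d,S)`-independent if, for all
`z₁, …, z_d ∈ D` (repetitions allowed) and for `f` uniform on `F`, the tuple of the values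
`f (z j)` with `z j ∉ S` is independent of the tuple of the values `f (z j)` with `z j ∈ S`
together with `P f`. -/
def IsIndependentProperty {D R : Type*} (F : Set (D → R)) (P : F → Bool) (d : ℕ)
    (S : Finset D) : Prop :=
  ∀ z : Fin d → D,
    UniformIndep
      (fun (f : F) (j : {j : Fin d // z j ∉ S}) => f.1 (z j.1))
      (fun (f : F) => ((fun (j : {j : Fin d // z j ∈ S}) => f.1 (z j.1)), P f))

/-- A distribution `Δ` of maps `X : {1, …, N} → D` is a permutation-independent distribution of
input maps if it is carried by the maps onto `D`, and `σ ∘ X` has the same probability as `X`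
for every permutation `σ` of `D`. -/
def IsPermutationIndependent {N : ℕ} {D : Type*} (Δ : PMF (Fin N → D)) : Prop :=
  (∀ X ∈ Δ.support, Function.Surjective X) ∧
    ∀ (σ : Equiv.Perm D) (X : Fin N → D), Δ (σ ∘ X) = Δ X

/-- The addition that the oracle uses to write its answer into registers with basis states `A`
(for the point `x`) and `B` (for the value `y`). For each answer, `a ↦ a + x` and `b ↦ b + y` have
to be reversible; `A = D` and `B = R` with group structures are the typical case. -/
structure OracleAddition (D R A B : Type*) where
  addPoint : D → Equiv.Perm A
  addValue : R → Equiv.Perm B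

/-- The classical action `(i, a, b, c) ↦ (i, a + X i, b + Y i, c)` of the oracle `(X, Y)` on the
computational basis. -/
def OracleAddition.oraclePerm {N : ℕ} {D R A B : Type*} (add : OracleAddition D R A B)
    (W : Type*) (X : Fin N → D) (Y : Fin N → R) : Equiv.Perm (Fin N × A × B × W) where
  toFun s := (s.1, add.addPoint (X s.1) s.2.1, add.addValue (Y s.1) s.2.2.1, s.2.2.2)
  invFun s :=
    (s.1, (add.addPoint (X s.1)).symm s.2.1, (add.addValue (Y s.1)).symm s.2.2.1, s.2.2.2)
  left_inv s := by simp
  right_inv s := by simp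

/-- A quantum query algorithm in the random-input model, with index register `{1, …, N}`, answer
registers `A`, `B` and finite workspace `W`: a unit initial state, the number of queries, the
unitaries (`unitary t` is applied right after the query number `t + 1`; only those with
`t < numQueries` matter), and the output bit read off from a final measurement in the
computational basis. -/
structure QueryAlgorithm (N : ℕ) (D R A B W : Type*) [Fintype A] [Fintype B] [Fintype W]
    [DecidableEq A] [DecidableEq B] [DecidableEq W] where
  add : OracleAddition D R A B
  init : Fin N × A × B × W → ℂ
  init_unit : ∑ s, ‖init s‖ ^ 2 = 1
  numQueries : ℕ
  unitary : ℕ → Matrix.unitaryGroup (Fin N × A × B × W) ℂ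
  output : Fin N × A × B × W → Bool

namespace QueryAlgorithm

variable {N : ℕ} {D R A B W : Type*} [Fintype A] [Fintype B] [Fintype W]
  [DecidableEq A] [DecidableEq B] [DecidableEq W]

/-- The state after `t` queries to the oracle `(X, Y)`, each followed by its unitary. A query
maps the basis state `|s⟩` to `|oraclePerm s⟩`. -/
noncomputable def state (Q : QueryAlgorithm N D R A B W) (X : Fin N → D) (Y : Fin N → R) :
    ℕ → (Fin N × A × B × W → ℂ)
  | 0 => Q.init
  | t + 1 => (Q.unitary t).1.mulVec
      (fun s => Q.state X Y t ((Q.add.oraclePerm W X Y).symm s))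

/-- The probability that the algorithm outputs the bit `b` on the oracle `(X, Y)`. -/
noncomputable def outputProb (Q : QueryAlgorithm N D R A B W) (X : Fin N → D) (Y : Fin N → R) (b : Bool) : ℝ :=
  ∑ s with Q.output s = b, ‖Q.state X Y Q.numQueries s‖ ^ 2

/-- For every `f ∈ F`, with `X` drawn from `Δ` and oracle `(X, f ∘ X)`, the algorithm outputs
`P f` with probability at least `1/2 + ε` (over `X` and the measurement). -/
def ComputesWithBias [Fintype D] (Q : QueryAlgorithm N D R A B W) (F : Set (D → R))
    (P : F → Bool) (Δ : PMF (Fin N → D)) (ε : ℝ) : Prop :=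
  ∀ f : F, 1 / 2 + ε ≤ ∑ X : Fin N → D, (Δ X).toReal * Q.outputProb X (f.1 ∘ X) (P f)

end QueryAlgorithm

end RandomInput

/-! The argument combines the polynomial method with a hybrid argument. After `q` queries an
acceptance probability is a combination of functions of at most `2q` values of the input function.
If `2q ≤ d`, independence therefore allows the values outside `S` to be redrawn from an independent
member `f` of the family without changing the average over the `g` with `P g = b`
(`IsIndependentProperty.card_mul_sum`). Both classes then share the same background outside `S`, so
the gap `2ε` must come from the values on `S` alone (`ComputesWithBias.two_mul_le`).

Those values are hard to reach when `S` is small. Choose `m` disjoint copies of `S` outside it, and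
let the points of one copy pose as points of `S`, with values from `g'` while `S` itself keeps `g`.
This false oracle differs from the true one for `g` only on that copy, so for an average copy it is
noticed with advantage at most `4q/√m` (`sum_abs_outputProb_sub_le`). Swapping `S` with the copy
exchanges `g` and `g'` and preserves `Δ`, so the same false oracle is equally close to the true one
for `g'`. Hence `g` and `g'` are separated by at most `8q/√m` (`mul_acceptProb_sub_le`), which
forces `q ≥ ε√m/4`. -/

namespace RandomInput

/-! ### Norms of amplitude vectors -/

section EuclideanNorm

variable {ι : Type*} [Fintype ι]

/-- The Euclidean norm of a vector of amplitudes. -/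
noncomputable def l2norm (v : ι → ℂ) : ℝ := ‖(WithLp.toLp 2 v : EuclideanSpace ℂ ι)‖

theorem l2norm_nonneg (v : ι → ℂ) : 0 ≤ l2norm v := norm_nonneg _

theorem l2norm_sq (v : ι → ℂ) : l2norm v ^ 2 = ∑ s, ‖v s‖ ^ 2 := by
  simp [l2norm, EuclideanSpace.norm_sq_eq]

theorem l2norm_add_le (v w : ι → ℂ) : l2norm (v + w) ≤ l2norm v + l2norm w := by
  simpa [l2norm] using
    norm_add_le (WithLp.toLp 2 v : EuclideanSpace ℂ ι) (WithLp.toLp 2 w : EuclideanSpace ℂ ι)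

theorem l2norm_sub_le (v w : ι → ℂ) : l2norm (v - w) ≤ l2norm v + l2norm w := by
  simpa [l2norm] using
    norm_sub_le (WithLp.toLp 2 v : EuclideanSpace ℂ ι) (WithLp.toLp 2 w : EuclideanSpace ℂ ι)

theorem abs_l2norm_sub_l2norm_le (v w : ι → ℂ) : |l2norm v - l2norm w| ≤ l2norm (v - w) := by
  simpa [l2norm] using
    abs_norm_sub_norm_le (WithLp.toLp 2 v : EuclideanSpace ℂ ι)
      (WithLp.toLp 2 w : EuclideanSpace ℂ ι)

theorem l2norm_comp_perm (σ : Equiv.Perm ι) (v : ι → ℂ) : l2norm (fun s => v (σ s)) = l2norm v := by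
  rw [← sq_eq_sq₀ (l2norm_nonneg _) (l2norm_nonneg _), l2norm_sq, l2norm_sq]
  exact Equiv.sum_comp σ fun s => ‖v s‖ ^ 2

theorem l2norm_unitary_mulVec [DecidableEq ι] (U : Matrix.unitaryGroup ι ℂ) (v : ι → ℂ) :
    l2norm (U.1.mulVec v) = l2norm v := by
  -- In the form `star w ⬝ᵥ w`, the identity `star U * U = 1` applies directly.
  have key : ∀ w : ι → ℂ, ((l2norm w ^ 2 : ℝ) : ℂ) = star w ⬝ᵥ w := by
    intro w
    rw [l2norm_sq]
    push_cast
    refine Finset.sum_congr rfl fun s _ => ?_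
    simp [Complex.conj_mul']
  rw [← sq_eq_sq₀ (l2norm_nonneg _) (l2norm_nonneg _), ← Complex.ofReal_inj, key, key,
    Matrix.star_mulVec, Matrix.dotProduct_mulVec, Matrix.vecMul_vecMul,
    ← Matrix.star_eq_conjTranspose, Unitary.coe_star_mul_self, Matrix.vecMul_one]

theorem l2norm_indicator_sq (T : Set ι) [DecidablePred (· ∈ T)] (v : ι → ℂ) :
    l2norm (T.indicator v) ^ 2 = ∑ s with s ∈ T, ‖v s‖ ^ 2 := by
  rw [l2norm_sq, Finset.sum_filter]
  refine Finset.sum_congr rfl fun s _ => ?_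
  by_cases h : s ∈ T <;> simp [h]

theorem l2norm_indicator_le (T : Set ι) (v : ι → ℂ) : l2norm (T.indicator v) ≤ l2norm v := by
  classical
  rw [← sq_le_sq₀ (l2norm_nonneg _) (l2norm_nonneg _), l2norm_indicator_sq, l2norm_sq]
  exact Finset.sum_le_sum_of_subset_of_nonneg (Finset.filter_subset _ _) fun _ _ _ => by positivity

/-- The difference of squares factors; for unit vectors the sum of the two norms is at most 2. -/
theorem abs_sum_norm_sq_sub_le (T : Set ι) [DecidablePred (· ∈ T)] {v w : ι → ℂ}
    (hv : l2norm v = 1) (hw : l2norm w = 1) :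
    |∑ s with s ∈ T, ‖v s‖ ^ 2 - ∑ s with s ∈ T, ‖w s‖ ^ 2| ≤ 2 * l2norm (v - w) := by
  rw [← l2norm_indicator_sq, ← l2norm_indicator_sq, sq_sub_sq, abs_mul]
  have h1 : |l2norm (T.indicator v) + l2norm (T.indicator w)| ≤ 2 := by
    rw [abs_of_nonneg (add_nonneg (l2norm_nonneg _) (l2norm_nonneg _))]
    linarith [l2norm_indicator_le T v, l2norm_indicator_le T w]
  have h2 : |l2norm (T.indicator v) - l2norm (T.indicator w)| ≤ l2norm (v - w) := by
    refine (abs_l2norm_sub_l2norm_le _ _).trans ?_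
    rw [← Set.indicator_sub']
    exact l2norm_indicator_le T (v - w)
  exact mul_le_mul h1 h2 (abs_nonneg _) zero_le_two

/-- The masses that a unit vector puts on `m` disjoint sets have norms adding up to at most `√m`. -/
theorem sum_l2norm_indicator_le {κ : Type*} [Fintype κ] (T : κ → Set ι)
    (hT : ∀ s j j', s ∈ T j → s ∈ T j' → j = j') {v : ι → ℂ} (hv : l2norm v = 1) :
    ∑ j, l2norm ((T j).indicator v) ≤ √(Fintype.card κ) := by
  classical
  have h1 : ∑ j, l2norm ((T j).indicator v) ^ 2 ≤ 1 := by
    have : (1 : ℝ) = l2norm v ^ 2 := by rw [hv]; norm_num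
    rw [this, l2norm_sq]
    simp_rw [l2norm_sq]
    rw [Finset.sum_comm]
    refine Finset.sum_le_sum fun s _ => ?_
    by_cases h : ∃ j, s ∈ T j
    · obtain ⟨j, hj⟩ := h
      rw [Finset.sum_eq_single j]
      · simp [hj]
      · intro j' _ hj'
        have : s ∉ T j' := fun h' => hj' (hT s _ _ h' hj)
        simp [this]
      · simp
    · push Not at h
      simp [h]
  refine Real.le_sqrt_of_sq_le ?_
  calc (∑ j, l2norm ((T j).indicator v)) ^ 2
      ≤ (Fintype.card κ : ℝ) * ∑ j, l2norm ((T j).indicator v) ^ 2 := by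
        simpa using sq_sum_le_card_mul_sum_sq (s := Finset.univ)
          (f := fun j => l2norm ((T j).indicator v))
    _ ≤ Fintype.card κ := mul_le_of_le_one_right (Nat.cast_nonneg _) h1

end EuclideanNorm

/-! ### The hybrid argument -/

namespace QueryAlgorithm

variable {N : ℕ} {D R A B W : Type*} [Fintype A] [Fintype B] [Fintype W]
  [DecidableEq A] [DecidableEq B] [DecidableEq W]

theorem l2norm_state (Q : QueryAlgorithm N D R A B W) (X : Fin N → D) (Y : Fin N → R) (t : ℕ) :
    l2norm (Q.state X Y t) = 1 := by
  induction t with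
  | zero =>
    rw [← sq_eq_sq₀ (l2norm_nonneg _) zero_le_one, l2norm_sq]
    simpa [state] using Q.init_unit
  | succ t ih =>
    rw [state, l2norm_unitary_mulVec, l2norm_comp_perm, ih]

theorem outputProb_true_add_false (Q : QueryAlgorithm N D R A B W) (X : Fin N → D)
    (Y : Fin N → R) : Q.outputProb X Y true + Q.outputProb X Y false = 1 := by
  have h : ∑ s, ‖Q.state X Y Q.numQueries s‖ ^ 2 = 1 := by
    rw [← l2norm_sq, l2norm_state, one_pow]
  rw [← h, ← Finset.sum_filter_add_sum_filter_not Finset.univ (fun s => Q.output s = true)]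
  simp [outputProb]

/-- The event that the index register lies in `E`. -/
def indexIn (A B W : Type*) (E : Set (Fin N)) : Set (Fin N × A × B × W) := {s | s.1 ∈ E}

/-- Two oracles that agree outside `E` can be told apart only by querying `E`. -/
theorem l2norm_state_sub_le (Q : QueryAlgorithm N D R A B W) {X X' : Fin N → D}
    {Y Y' : Fin N → R} {E : Set (Fin N)} (hX : ∀ i ∉ E, X i = X' i) (hY : ∀ i ∉ E, Y i = Y' i)
    (t : ℕ) :
    l2norm (Q.state X Y t - Q.state X' Y' t) ≤
      ∑ r ∈ Finset.range t, 2 * l2norm ((indexIn A B W E).indicator (Q.state X Y r)) := by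
  induction t with
  | zero => simp [state, l2norm]
  | succ t ih =>
    rw [Finset.sum_range_succ, state, state, ← Matrix.mulVec_sub, l2norm_unitary_mulVec]
    set v := Q.state X Y t
    set v' := Q.state X' Y' t
    set O := (Q.add.oraclePerm W X Y).symm with hO
    set O' := (Q.add.oraclePerm W X' Y').symm with hO'
    set T := indexIn A B W E
    have hOT : ∀ s, O s ∈ T ↔ s ∈ T := fun s => Iff.rfl
    have hOT' : ∀ s, O' s ∈ T ↔ s ∈ T := fun s => Iff.rfl
    have hOO : ∀ s, s ∉ T → O s = O' s := by
      intro s hs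
      change (s.1, (Q.add.addPoint (X s.1)).symm s.2.1,
          (Q.add.addValue (Y s.1)).symm s.2.2.1, s.2.2.2) =
        (s.1, (Q.add.addPoint (X' s.1)).symm s.2.1,
          (Q.add.addValue (Y' s.1)).symm s.2.2.1, s.2.2.2)
      rw [hX _ hs, hY _ hs]
    -- Off `T` the two queries act alike, so new discrepancy comes only from the part of `v` on `T`;
    -- the old discrepancy `v - v'` is merely permuted.
    have hsplit : ((fun s => v (O s)) - fun s => v' (O' s)) =
        ((fun s => T.indicator v (O s)) - fun s => T.indicator v (O' s)) +
          fun s => (v - v') (O' s) := by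
      funext s
      by_cases hs : s ∈ T
      · simp [(hOT s).2 hs, (hOT' s).2 hs]
      · have h1 : O s ∉ T := fun h => hs ((hOT s).1 h)
        have h2 : O' s ∉ T := fun h => hs ((hOT' s).1 h)
        simp [h2, hOO s hs]
    rw [hsplit]
    refine (l2norm_add_le _ _).trans ?_
    rw [l2norm_comp_perm O' (v - v'), add_comm]
    refine add_le_add ih ((l2norm_sub_le _ _).trans ?_)
    rw [l2norm_comp_perm O (T.indicator v), l2norm_comp_perm O' (T.indicator v)]
    linarith

/-- The hybrid bound: changing the oracle on one of `m` disjoint sets of indices changes the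
output probability by at most `4 q / √m` on average. -/
theorem sum_abs_outputProb_sub_le {κ : Type*} [Fintype κ] (Q : QueryAlgorithm N D R A B W)
    (X : Fin N → D) (Y : Fin N → R) (X' : κ → Fin N → D) (Y' : κ → Fin N → R)
    (E : κ → Set (Fin N)) (hE : ∀ i j j', i ∈ E j → i ∈ E j' → j = j')
    (hX : ∀ j, ∀ i ∉ E j, X i = X' j i) (hY : ∀ j, ∀ i ∉ E j, Y i = Y' j i) (b : Bool) :
    ∑ j, |Q.outputProb X Y b - Q.outputProb (X' j) (Y' j) b| ≤
      4 * Q.numQueries * √(Fintype.card κ) := by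
  calc ∑ j, |Q.outputProb X Y b - Q.outputProb (X' j) (Y' j) b|
      ≤ ∑ j, ∑ r ∈ Finset.range Q.numQueries,
          4 * l2norm ((indexIn A B W (E j)).indicator (Q.state X Y r)) := by
        refine Finset.sum_le_sum fun j _ => ?_
        refine (abs_sum_norm_sq_sub_le {s | Q.output s = b} (Q.l2norm_state X Y Q.numQueries)
          (Q.l2norm_state (X' j) (Y' j) Q.numQueries)).trans ?_
        refine (mul_le_mul_of_nonneg_left
          (Q.l2norm_state_sub_le (hX j) (hY j) Q.numQueries) zero_le_two).trans_eq ?_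
        rw [Finset.mul_sum]
        exact Finset.sum_congr rfl fun r _ => by ring
    _ = ∑ r ∈ Finset.range Q.numQueries,
          4 * ∑ j, l2norm ((indexIn A B W (E j)).indicator (Q.state X Y r)) := by
        rw [Finset.sum_comm]
        simp_rw [Finset.mul_sum]
    _ ≤ ∑ r ∈ Finset.range Q.numQueries, 4 * √(Fintype.card κ) := by
        refine Finset.sum_le_sum fun r _ => mul_le_mul_of_nonneg_left ?_ (by norm_num)
        exact sum_l2norm_indicator_le _ (fun s j j' => hE s.1 j j') (Q.l2norm_state X Y r)
    _ = 4 * Q.numQueries * √(Fintype.card κ) := by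
        simp only [Finset.sum_const, Finset.card_range, nsmul_eq_mul]
        ring

end QueryAlgorithm

/-! ### The polynomial method: amplitudes as functions of few values -/

section FewPoints

variable {D R : Type*}

/-- The linear combinations of functions of `f : D → R` that depend on at most `k` values of `f`. -/
def fewPoints (D R : Type*) (k : ℕ) : Submodule ℂ ((D → R) → ℂ) :=
  Submodule.span ℂ {φ | ∃ T : Finset D, T.card ≤ k ∧ DependsOn φ T}

theorem mem_fewPoints_of_dependsOn {k : ℕ} {φ : (D → R) → ℂ} (T : Finset D) (hT : T.card ≤ k)
    (h : DependsOn φ T) : φ ∈ fewPoints D R k :=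
  Submodule.subset_span ⟨T, hT, h⟩

theorem fewPoints_mono {k l : ℕ} (h : k ≤ l) : fewPoints D R k ≤ fewPoints D R l :=
  Submodule.span_mono fun _ ⟨T, hT, hφ⟩ => ⟨T, hT.trans h, hφ⟩

theorem mul_mem_fewPoints {k l : ℕ} {φ ψ : (D → R) → ℂ} (hφ : φ ∈ fewPoints D R k)
    (hψ : ψ ∈ fewPoints D R l) : φ * ψ ∈ fewPoints D R (k + l) := by
  classical
  have h := Submodule.mul_mem_mul hφ hψ
  rw [fewPoints, fewPoints, Submodule.span_mul_span] at h
  refine Submodule.span_le.2 ?_ h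
  rintro _ ⟨φ, ⟨T, hT, hφT⟩, ψ, ⟨T', hT', hψT'⟩, rfl⟩
  refine mem_fewPoints_of_dependsOn (T ∪ T') ((Finset.card_union_le T T').trans (by omega)) ?_
  intro f g hfg
  simp only [Pi.mul_apply]
  rw [hφT fun i hi => hfg i (by simp at hi ⊢; exact .inl hi),
    hψT' fun i hi => hfg i (by simp at hi ⊢; exact .inr hi)]

theorem conj_mem_fewPoints {k : ℕ} {φ : (D → R) → ℂ} (hφ : φ ∈ fewPoints D R k) :
    (fun f => (starRingEnd ℂ) (φ f)) ∈ fewPoints D R k := by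
  induction hφ using Submodule.span_induction with
  | mem φ h =>
    obtain ⟨T, hT, h⟩ := h
    exact mem_fewPoints_of_dependsOn T hT fun f g hfg => congrArg _ (h hfg)
  | zero => simp [← Pi.zero_def]
  | add φ ψ _ _ h1 h2 => simpa using! (fewPoints D R k).add_mem h1 h2
  | smul c φ _ h => simpa using! (fewPoints D R k).smul_mem ((starRingEnd ℂ) c) h

namespace QueryAlgorithm

variable {N : ℕ} {A B W : Type*} [Fintype A] [Fintype B] [Fintype W]
  [DecidableEq A] [DecidableEq B] [DecidableEq W]

theorem state_mem_fewPoints (Q : QueryAlgorithm N D R A B W) (X : Fin N → D) (t : ℕ)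
    (s : Fin N × A × B × W) : (fun f : D → R => Q.state X (f ∘ X) t s) ∈ fewPoints D R t := by
  induction t generalizing s with
  | zero => exact mem_fewPoints_of_dependsOn ∅ (by simp) fun f g _ => rfl
  | succ t ih =>
    have hquery : ∀ s' : Fin N × A × B × W,
        (fun f : D → R => Q.state X (f ∘ X) t ((Q.add.oraclePerm W X (f ∘ X)).symm s')) ∈
          fewPoints D R (t + 1) := by
      intro s'
      -- Summing over all possible contents `b` of the value register separates the amplitude, known
      -- by induction, from an indicator that depends on the single value `f (X s'.1)`.
      have hsum : (fun f : D → R =>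
          Q.state X (f ∘ X) t ((Q.add.oraclePerm W X (f ∘ X)).symm s')) =
          ∑ b : B, (fun f : D → R => Q.state X (f ∘ X) t
              (s'.1, (Q.add.addPoint (X s'.1)).symm s'.2.1, b, s'.2.2.2)) *
            (fun f : D → R =>
              if b = (Q.add.addValue (f (X s'.1))).symm s'.2.2.1 then (1 : ℂ) else 0) := by
        funext f
        simp only [Finset.sum_apply, Pi.mul_apply, mul_ite, mul_one, mul_zero,
          Finset.sum_ite_eq', Finset.mem_univ, if_true]
        rfl
      rw [hsum]
      refine Submodule.sum_mem _ fun b _ => mul_mem_fewPoints (ih _) ?_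
      refine mem_fewPoints_of_dependsOn {X s'.1} (by simp) fun f g hfg => ?_
      simp only [hfg (X s'.1) (by simp)]
    have hmul : (fun f : D → R => Q.state X (f ∘ X) (t + 1) s) =
        ∑ s', (Q.unitary t).1 s s' • fun f : D → R =>
          Q.state X (f ∘ X) t ((Q.add.oraclePerm W X (f ∘ X)).symm s') := by
      funext f
      simp [state, Matrix.mulVec, dotProduct]
    rw [hmul]
    exact Submodule.sum_mem _ fun s' _ => Submodule.smul_mem _ _ (hquery s')

/-- Squaring the modulus multiplies an amplitude by its conjugate, which doubles the number of
values. -/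
theorem outputProb_mem_fewPoints (Q : QueryAlgorithm N D R A B W) (X : Fin N → D) (b : Bool) :
    (fun f : D → R => (Q.outputProb X (f ∘ X) b : ℂ)) ∈ fewPoints D R (2 * Q.numQueries) := by
  have h : (fun f : D → R => (Q.outputProb X (f ∘ X) b : ℂ)) =
      ∑ s with Q.output s = b,
        (fun f : D → R => (starRingEnd ℂ) (Q.state X (f ∘ X) Q.numQueries s)) *
          fun f : D → R => Q.state X (f ∘ X) Q.numQueries s := by
    funext f
    simp [outputProb, Complex.conj_mul']
  rw [h, two_mul]
  exact Submodule.sum_mem _ fun s _ =>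
    mul_mem_fewPoints (conj_mem_fewPoints (Q.state_mem_fewPoints X _ s))
      (Q.state_mem_fewPoints X _ s)

end QueryAlgorithm

end FewPoints

/-! ### Independence as an identity between finite sums -/

section Independence

variable {Ω α β : Type*} [Fintype Ω] {U : Ω → α} {V : Ω → β}

open Classical in
theorem UniformIndep.card_mul_card (h : UniformIndep U V) (u : α) (v : β) :
    Fintype.card Ω * Finset.card {ω | U ω = u ∧ V ω = v} =
      Finset.card {ω | U ω = u} * Finset.card {ω | V ω = v} := by
  let _ : MeasurableSpace Ω := ⊤
  let _ : MeasurableSpace α := ⊤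
  let _ : MeasurableSpace β := ⊤
  have hcount : ∀ (p : Ω → Prop) [DecidablePred p],
      ProbabilityTheory.uniformOn (Set.univ : Set Ω) {ω | p ω} =
      (Finset.card {ω | p ω} : ENNReal) / Fintype.card Ω := by
    intro p _
    rw [ProbabilityTheory.uniformOn_univ]
    congr 1
    rw [← MeasureTheory.Measure.count_apply_finset]
    simp
  have h' : ProbabilityTheory.IndepFun U V (ProbabilityTheory.uniformOn Set.univ) := h
  have key := h'.measure_inter_preimage_eq_mul (s := {u}) (t := {v}) trivial trivial
  change ProbabilityTheory.uniformOn _ {ω | U ω = u ∧ V ω = v} =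
    ProbabilityTheory.uniformOn _ {ω | U ω = u} * ProbabilityTheory.uniformOn _ {ω | V ω = v} at key
  rw [hcount, hcount, hcount] at key
  rcases isEmpty_or_nonempty Ω with hΩ | hΩ
  · simp [Finset.univ_eq_empty]
  · have hne : (Fintype.card Ω : ℝ) ≠ 0 := Nat.cast_ne_zero.2 Fintype.card_ne_zero
    have key' := congrArg ENNReal.toReal key
    simp only [ENNReal.toReal_div, ENNReal.toReal_mul, ENNReal.toReal_natCast] at key'
    field_simp at key'
    rw [mul_comm]
    exact_mod_cast key'

/-- The joint average over independent variables is the average over independent copies. -/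
theorem UniformIndep.card_mul_sum (h : UniformIndep U V) (G : α → β → ℂ) :
    (Fintype.card Ω : ℂ) * ∑ ω, G (U ω) (V ω) = ∑ ω, ∑ ω', G (U ω) (V ω') := by
  classical
  have h1 : ∑ ω, G (U ω) (V ω) = ∑ p ∈ Finset.univ.image U ×ˢ Finset.univ.image V,
      (Finset.card {ω | U ω = p.1 ∧ V ω = p.2} : ℂ) * G p.1 p.2 := by
    rw [← Finset.sum_fiberwise_of_maps_to (g := fun ω => (U ω, V ω))
      (t := Finset.univ.image U ×ˢ Finset.univ.image V) (fun ω _ => by simp)]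
    refine Finset.sum_congr rfl fun p _ => ?_
    rw [← nsmul_eq_mul, ← Finset.sum_const]
    refine Finset.sum_congr (by ext; simp [Prod.ext_iff]) fun ω hω => ?_
    simp only [Finset.mem_filter, Finset.mem_univ, true_and] at hω
    rw [hω.1, hω.2]
  have h2 : ∑ ω, ∑ ω', G (U ω) (V ω') = ∑ p ∈ Finset.univ.image U ×ˢ Finset.univ.image V,
      ((Finset.card {ω | U ω = p.1} * Finset.card {ω | V ω = p.2} : ℕ) : ℂ) * G p.1 p.2 := by
    rw [Finset.sum_product, Finset.sum_comp (fun u => ∑ ω', G u (V ω')) U]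
    refine Finset.sum_congr rfl fun u _ => ?_
    rw [Finset.sum_comp (fun v => G u v) V, Finset.smul_sum]
    refine Finset.sum_congr rfl fun v _ => ?_
    simp only [nsmul_eq_mul]
    push_cast
    ring
  rw [h1, h2, Finset.mul_sum]
  refine Finset.sum_congr rfl fun p _ => ?_
  rw [← h.card_mul_card p.1 p.2]
  push_cast
  ring

end Independence

/-! ### Redrawing the values outside `S` -/

section IndependentProperty

variable {D R : Type*} {F : Set (D → R)} [Fintype F] {P : F → Bool} {d : ℕ} {S : Finset D}

open Classical in
/-- For an independent property, replacing the values outside `S` by those of an independent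
member of the family does not change the averages of functions of few values. -/
theorem IsIndependentProperty.card_mul_sum [Nonempty D] (h : IsIndependentProperty F P d S)
    (b : Bool) {φ : (D → R) → ℂ} (hφ : φ ∈ fewPoints D R d) :
    (Fintype.card F : ℂ) * ∑ g : F with P g = b, φ g.1 =
      ∑ f : F, ∑ g : F with P g = b, φ (S.piecewise g.1 f.1) := by
  induction hφ using Submodule.span_induction with
  | zero => simp
  | add φ ψ _ _ h1 h2 => simp only [Pi.add_apply, Finset.sum_add_distrib, mul_add, h1, h2]
  | smul c φ _ h1 =>
    simp only [Pi.smul_apply, smul_eq_mul, ← Finset.mul_sum]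
    rw [← h1]
    ring
  | mem φ hφ =>
    obtain ⟨T, hT, hφT⟩ := hφ
    -- List `T` and pad with an arbitrary point up to length `d`; this is where repetitions among
    -- the `z j` are needed.
    obtain ⟨z, hz⟩ : ∃ z : Fin d → D, ∀ x ∈ T, ∃ j, z j = x := by
      refine ⟨fun j => if hj : j.1 < T.card then (T.equivFin.symm ⟨j, hj⟩ : D)
        else Classical.arbitrary D, fun x hx => ?_⟩
      refine ⟨⟨T.equivFin ⟨x, hx⟩, (T.equivFin ⟨x, hx⟩).2.trans_le hT⟩, ?_⟩
      simp
    set U := fun (f : F) (j : {j : Fin d // z j ∉ S}) => f.1 (z j.1)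
    set V := fun (f : F) => ((fun (j : {j : Fin d // z j ∈ S}) => f.1 (z j.1)), P f)
    let Ψ : F × F → ℂ := fun p => if P p.2 = b then φ (S.piecewise p.2.1 p.1.1) else 0
    -- At each `z j` the spliced function reads `g` inside `S` and `f` outside, so `Ψ` sees only `U
    -- f` and `V g`. On the diagonal `f = g` the splice is `g` itself.
    have hfac : Function.FactorsThrough Ψ fun p : F × F => (U p.1, V p.2) := by
      rintro ⟨f, g⟩ ⟨f', g'⟩ hfg
      simp only [Prod.mk.injEq, U, V, funext_iff] at hfg
      obtain ⟨hf, hg, hP⟩ := hfg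
      simp only [Ψ, hP]
      congr 1
      refine hφT fun x hx => ?_
      obtain ⟨j, rfl⟩ := hz x hx
      by_cases hj : z j ∈ S
      · simpa [hj] using hg ⟨j, hj⟩
      · simpa [hj] using hf ⟨j, hj⟩
    obtain ⟨G, hG⟩ := (Function.factorsThrough_iff Ψ).1 hfac
    have hG' : ∀ f g, G (U f, V g) = if P g = b then φ (S.piecewise g.1 f.1) else 0 :=
      fun f g => (congrFun hG (f, g)).symm
    have := (h z).card_mul_sum fun u v => G (u, v)
    change (Fintype.card F : ℂ) * ∑ f, G (U f, V f) = ∑ f, ∑ g, G (U f, V g) at this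
    simpa only [hG', Finset.piecewise_same, Finset.sum_filter] using this

end IndependentProperty

/-! ### Disjoint copies of `S` and the false oracle -/

section Swaps

variable {D R : Type*}

/-- If `m + 1` copies of `S` fit into `D`, then there are `m` involutions of `D` that exchange `S`
with pairwise disjoint sets outside `S` and fix all other points. -/
theorem exists_disjoint_swaps [Fintype D] (S : Finset D) (m : ℕ)
    (h : S.card * (m + 1) ≤ Fintype.card D) :
    ∃ σ : Fin m → Equiv.Perm D, (∀ j x, σ j (σ j x) = x) ∧ (∀ j, ∀ x ∈ S, σ j x ∉ S) ∧
      (∀ j, ∀ x ∉ S, σ j x ∉ S → σ j x = x) ∧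
      ∀ x ∉ S, ∀ j j', σ j x ∈ S → σ j' x ∈ S → j = j' := by
  classical
  -- `e` lays out `m` disjoint labelled copies of `S` in its complement; `τ j` exchanges `S` with
  -- the copy number `j`.
  obtain ⟨e⟩ : Nonempty ((S × Fin m) ↪ {x // x ∉ S}) := by
    refine Function.Embedding.nonempty_of_card_le ?_
    rw [Fintype.card_prod, Fintype.card_coe, Fintype.card_fin, Fintype.card_subtype_compl,
      Fintype.card_coe]
    rw [mul_add] at h
    omega
  let τ : Fin m → D → D := fun j x =>
    if hx : x ∈ S then (e (⟨x, hx⟩, j) : D)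
    else if hx' : ∃ s : S, (e (s, j) : D) = x then (hx'.choose : D) else x
  have hin : ∀ j (s : S), τ j s = e (s, j) := fun j s => by simp [τ]
  have hout : ∀ j (s : S), τ j (e (s, j)) = s := by
    intro j s
    have hex : ∃ s' : S, (e (s', j) : D) = e (s, j) := ⟨s, rfl⟩
    simp only [τ]
    rw [dif_neg (e (s, j)).2, dif_pos hex]
    have := e.injective (Subtype.ext hex.choose_spec)
    exact congrArg Subtype.val (Prod.ext_iff.1 this).1
  have hfix : ∀ j x, x ∉ S → (¬ ∃ s : S, (e (s, j) : D) = x) → τ j x = x := by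
    intro j x hx hx'
    simp only [τ]
    rw [dif_neg hx, dif_neg hx']
  have hinv : ∀ j, Function.Involutive (τ j) := by
    intro j x
    by_cases hx : x ∈ S
    · exact (congrArg (τ j) (hin j ⟨x, hx⟩)).trans (hout j ⟨x, hx⟩)
    · by_cases hx' : ∃ s : S, (e (s, j) : D) = x
      · obtain ⟨s, rfl⟩ := hx'
        rw [hout, hin]
      · rw [hfix j x hx hx', hfix j x hx hx']
  have hblock : ∀ j, ∀ x ∉ S, τ j x ∈ S → ∃ s : S, (e (s, j) : D) = x := by
    intro j x hx hτ
    by_contra hx'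
    rw [hfix j x hx hx'] at hτ
    exact hx hτ
  refine ⟨fun j => (hinv j).toPerm, fun j x => hinv j x, fun j x hx => ?_, fun j x hx hx' => ?_,
    fun x hx j j' hj hj' => ?_⟩
  · change τ j (⟨x, hx⟩ : S) ∉ S
    rw [hin]
    exact (e _).2
  · refine hfix j x hx ?_
    rintro ⟨s, rfl⟩
    refine hx' ?_
    change τ j (e (s, j)) ∈ S
    rw [hout]
    exact s.2
  · obtain ⟨s, hs⟩ := hblock j x hx hj
    obtain ⟨s', hs'⟩ := hblock j' x hx hj'
    have := e.injective (Subtype.ext (hs.trans hs'.symm))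
    exact (Prod.ext_iff.1 this).2

variable (S : Finset D) (σ : Equiv.Perm D) (f g g' : D → R)

open Classical in
/-- The oracle answer at a point `x` of `D` in which both `S` and `σ S` pose as `S`: on `S` the
values are taken from `g`, on `σ S` from `g'`, and elsewhere from `f`. -/
noncomputable def doubledAnswer (x : D) : D × R :=
  if x ∈ S then (x, g x) else if σ x ∈ S then (σ x, g' (σ x)) else (x, f x)

/-- This symmetry makes one false oracle serve both `g` and `g'`: relabelling points by `σ`
exchanges the genuine and the posing copy. -/
theorem doubledAnswer_apply_perm (hinv : ∀ x, σ (σ x) = x) (hS : ∀ x ∈ S, σ x ∉ S)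
    (hfix : ∀ x ∉ S, σ x ∉ S → σ x = x) (x : D) :
    doubledAnswer S σ f g g' (σ x) = doubledAnswer S σ f g' g x := by
  by_cases h1 : x ∈ S
  · simp [doubledAnswer, h1, hS x h1, hinv]
  · by_cases h2 : σ x ∈ S
    · simp [doubledAnswer, h1, h2]
    · simp [doubledAnswer, h1, hfix x h1 h2]

end Swaps

theorem sum_toReal_pmf {α : Type*} [Fintype α] (p : PMF α) :
    ∑ a, (p a).toReal = 1 := by
  rw [← ENNReal.toReal_sum fun a _ => p.apply_ne_top a, ← tsum_fintype (L := .unconditional _),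
    p.tsum_coe, ENNReal.toReal_one]

theorem IsPermutationIndependent.sum_comp_perm {N : ℕ} {D : Type*} [Fintype D]
    {Δ : PMF (Fin N → D)} (hΔ : IsPermutationIndependent Δ) (σ : Equiv.Perm D)
    (φ : (Fin N → D) → ℝ) :
    ∑ X, (Δ X).toReal * φ (σ ∘ X) = ∑ X, (Δ X).toReal * φ X := by
  rw [← Equiv.sum_comp ((Equiv.refl (Fin N)).arrowCongr σ) fun X => (Δ X).toReal * φ X]
  refine Finset.sum_congr rfl fun X _ => ?_
  change _ = (Δ (σ ∘ X)).toReal * φ (σ ∘ X)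
  rw [hΔ.2]

/-! ### Bounding the bias from both sides -/

namespace QueryAlgorithm

variable {N : ℕ} {D R A B W : Type*} [Fintype D] [Fintype A] [Fintype B] [Fintype W]
  [DecidableEq A] [DecidableEq B] [DecidableEq W]

/-- The probability, over `X ∼ Δ` and the measurement, of the output `true` on the function `h`. -/
noncomputable def acceptProb (Q : QueryAlgorithm N D R A B W) (Δ : PMF (Fin N → D)) (h : D → R) :
    ℝ :=
  ∑ X : Fin N → D, (Δ X).toReal * Q.outputProb X (h ∘ X) true

theorem acceptProb_mem_fewPoints (Q : QueryAlgorithm N D R A B W) (Δ : PMF (Fin N → D)) :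
    (fun h : D → R => (Q.acceptProb Δ h : ℂ)) ∈ fewPoints D R (2 * Q.numQueries) := by
  have h : (fun h : D → R => (Q.acceptProb Δ h : ℂ)) =
      ∑ X : Fin N → D, ((Δ X).toReal : ℂ) •
        fun h : D → R => (Q.outputProb X (h ∘ X) true : ℂ) := by
    funext h
    simp [acceptProb]
  rw [h]
  exact Submodule.sum_mem _ fun X _ =>
    Submodule.smul_mem _ _ (Q.outputProb_mem_fewPoints X true)

theorem ComputesWithBias.le_acceptProb {Q : QueryAlgorithm N D R A B W} {F : Set (D → R)}
    {P : F → Bool} {Δ : PMF (Fin N → D)} {ε : ℝ} (hQ : Q.ComputesWithBias F P Δ ε) {f : F}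
    (hf : P f = true) : 1 / 2 + ε ≤ Q.acceptProb Δ f.1 := by
  simpa only [hf, acceptProb] using hQ f

theorem ComputesWithBias.acceptProb_le {Q : QueryAlgorithm N D R A B W} {F : Set (D → R)}
    {P : F → Bool} {Δ : PMF (Fin N → D)} {ε : ℝ} (hQ : Q.ComputesWithBias F P Δ ε) {f : F}
    (hf : P f = false) : Q.acceptProb Δ f.1 ≤ 1 / 2 - ε := by
  have h1 := hQ f
  simp only [hf] at h1
  have h2 : Q.acceptProb Δ f.1 +
      ∑ X : Fin N → D, (Δ X).toReal * Q.outputProb X (f.1 ∘ X) false = 1 := by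
    rw [acceptProb, ← Finset.sum_add_distrib]
    simp_rw [← mul_add, outputProb_true_add_false, mul_one, sum_toReal_pmf]
  linarith

open Classical in
/-- With at most `d / 2` queries, the bias is bounded by the effect that the values on `S` have on
the acceptance probability. -/
theorem ComputesWithBias.two_mul_le {Q : QueryAlgorithm N D R A B W} {F : Set (D → R)}
    [Fintype F] {P : F → Bool} (hP : Function.Surjective P) {d : ℕ} {S : Finset D}
    (hind : IsIndependentProperty F P d S) {Δ : PMF (Fin N → D)} {ε c : ℝ}
    (hQ : Q.ComputesWithBias F P Δ ε) (hd : 2 * Q.numQueries ≤ d)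
    (hc : ∀ f g g' : D → R,
      Q.acceptProb Δ (S.piecewise g f) - Q.acceptProb Δ (S.piecewise g' f) ≤ c) :
    2 * ε ≤ c := by
  obtain ⟨f₁, hf₁⟩ := hP true
  obtain ⟨f₀, hf₀⟩ := hP false
  -- On an empty domain there is only one function, so `P` could not take both values.
  have : Nonempty D := by
    by_contra hD
    rw [not_nonempty_iff] at hD
    rw [Subsingleton.elim f₁ f₀, hf₀] at hf₁
    exact Bool.false_ne_true hf₁
  have havg : ∀ b, (Fintype.card F : ℝ) * ∑ g : F with P g = b, Q.acceptProb Δ g.1 =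
      ∑ f : F, ∑ g : F with P g = b, Q.acceptProb Δ (S.piecewise g.1 f.1) := by
    intro b
    exact_mod_cast hind.card_mul_sum b (fewPoints_mono hd (Q.acceptProb_mem_fewPoints Δ))
  set F₁ : Finset F := {g | P g = true} with hF₁
  set F₀ : Finset F := {g | P g = false} with hF₀
  have hpos₁ : (0 : ℝ) < F₁.card := Nat.cast_pos.2 (Finset.card_pos.2 ⟨f₁, by simp [hF₁, hf₁]⟩)
  have hpos₀ : (0 : ℝ) < F₀.card := Nat.cast_pos.2 (Finset.card_pos.2 ⟨f₀, by simp [hF₀, hf₀]⟩)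
  have hpos : (0 : ℝ) < Fintype.card F := Nat.cast_pos.2 (Fintype.card_pos_iff.2 ⟨f₁⟩)
  have hlow : (F₁.card : ℝ) * (1 / 2 + ε) ≤ ∑ g ∈ F₁, Q.acceptProb Δ g.1 := by
    rw [← nsmul_eq_mul]
    refine Finset.card_nsmul_le_sum _ _ _ fun g hg => hQ.le_acceptProb ?_
    simpa [hF₁] using hg
  have hup : ∑ g ∈ F₀, Q.acceptProb Δ g.1 ≤ (F₀.card : ℝ) * (1 / 2 - ε) := by
    rw [← nsmul_eq_mul]
    refine Finset.sum_le_card_nsmul _ _ _ fun g hg => hQ.acceptProb_le ?_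
    simpa [hF₀] using hg
  -- For a fixed background `f`, compare every `g` of one class with every `g'` of the other; the
  -- weights `F₀.card` and `F₁.card` clear the denominators of the two class averages.
  have hpair : ∀ f : F, (F₀.card : ℝ) * ∑ g ∈ F₁, Q.acceptProb Δ (S.piecewise g.1 f.1) -
      F₁.card * ∑ g' ∈ F₀, Q.acceptProb Δ (S.piecewise g'.1 f.1) ≤ F₁.card * (F₀.card * c) := by
    intro f
    have : ∑ g ∈ F₁, ∑ g' ∈ F₀, (Q.acceptProb Δ (S.piecewise g.1 f.1) -
        Q.acceptProb Δ (S.piecewise g'.1 f.1)) ≤ ∑ g ∈ F₁, ∑ g' ∈ F₀, c :=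
      Finset.sum_le_sum fun g _ => Finset.sum_le_sum fun g' _ => hc f.1 g.1 g'.1
    simpa only [Finset.sum_sub_distrib, Finset.sum_const, nsmul_eq_mul, ← Finset.mul_sum]
      using this
  have hsum := Finset.sum_le_sum fun f (_ : f ∈ Finset.univ) => hpair f
  rw [Finset.sum_sub_distrib, ← Finset.mul_sum, ← Finset.mul_sum, ← havg, ← havg,
    Finset.sum_const, Finset.card_univ, nsmul_eq_mul] at hsum
  have h1 := mul_le_mul_of_nonneg_left hlow (mul_pos hpos₀ hpos).le
  have h0 := mul_le_mul_of_nonneg_left hup (mul_pos hpos₁ hpos).le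
  have hall : (Fintype.card F * F₁.card * F₀.card : ℝ) * (2 * ε) ≤
      (Fintype.card F * F₁.card * F₀.card : ℝ) * c := by linarith
  exact le_of_mul_le_mul_left hall (by positivity)

open Classical in
/-- If `m + 1` copies of `S` fit into `D`, then the values on `S` change the acceptance
probability by at most `8 q / √m`. -/
theorem mul_acceptProb_sub_le (Q : QueryAlgorithm N D R A B W) {Δ : PMF (Fin N → D)}
    (hΔ : IsPermutationIndependent Δ) (S : Finset D) (m : ℕ)
    (hm : S.card * (m + 1) ≤ Fintype.card D) (f g g' : D → R) :
    m * (Q.acceptProb Δ (S.piecewise g f) - Q.acceptProb Δ (S.piecewise g' f)) ≤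
      8 * Q.numQueries * √m := by
  obtain ⟨σ, hinv, hS, hfix, hdisj⟩ := exists_disjoint_swaps S m hm
  let p : Fin m → (D → R) → (D → R) → (Fin N → D) → ℝ := fun j g g' X =>
    Q.outputProb (fun i => (doubledAnswer S (σ j) f g g' (X i)).1)
      (fun i => (doubledAnswer S (σ j) f g g' (X i)).2) true
  have hhybrid : ∀ g g' : D → R,
      |m * Q.acceptProb Δ (S.piecewise g f) - ∑ j, ∑ X, (Δ X).toReal * p j g g' X| ≤
        4 * Q.numQueries * √m := by
    intro g g'
    have hX : ∀ X : Fin N → D, ∑ j, |Q.outputProb X (S.piecewise g f ∘ X) true - p j g g' X| ≤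
        4 * Q.numQueries * √m := by
      intro X
      have := Q.sum_abs_outputProb_sub_le X (S.piecewise g f ∘ X)
        (fun j i => (doubledAnswer S (σ j) f g g' (X i)).1)
        (fun j i => (doubledAnswer S (σ j) f g g' (X i)).2)
        (fun j => {i | X i ∉ S ∧ σ j (X i) ∈ S})
        (fun i j j' hj hj' => hdisj _ hj.1 j j' hj.2 hj'.2) ?_ ?_ true
      · simpa using this
      all_goals
        intro j i hi
        by_cases h : X i ∈ S
        · simp [doubledAnswer, h]
        · have h' : σ j (X i) ∉ S := fun h' => hi ⟨h, h'⟩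
          simp [doubledAnswer, h, h']
    have heq : m * Q.acceptProb Δ (S.piecewise g f) - ∑ j, ∑ X, (Δ X).toReal * p j g g' X =
        ∑ X, (Δ X).toReal *
          ∑ j, (Q.outputProb X (S.piecewise g f ∘ X) true - p j g g' X) := by
      rw [Finset.sum_comm, acceptProb, Finset.mul_sum, ← Finset.sum_sub_distrib]
      refine Finset.sum_congr rfl fun X _ => ?_
      rw [Finset.sum_sub_distrib, Finset.sum_const, Finset.card_univ, Fintype.card_fin,
        nsmul_eq_mul, mul_sub, Finset.mul_sum]
      ring
    rw [heq]
    calc _ ≤ ∑ X, |(Δ X).toReal *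
          ∑ j, (Q.outputProb X (S.piecewise g f ∘ X) true - p j g g' X)| :=
          Finset.abs_sum_le_sum_abs _ _
      _ ≤ ∑ X, (Δ X).toReal * (4 * Q.numQueries * √m) := by
          refine Finset.sum_le_sum fun X _ => ?_
          rw [abs_mul, abs_of_nonneg ENNReal.toReal_nonneg]
          exact mul_le_mul_of_nonneg_left
            ((Finset.abs_sum_le_sum_abs _ _).trans (hX X)) ENNReal.toReal_nonneg
      _ = 4 * Q.numQueries * √m := by rw [← Finset.sum_mul, sum_toReal_pmf, one_mul]
  -- Substitute `σ j ∘ X` for `X`, which `Δ` does not notice.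
  have hswap : ∑ j, ∑ X, (Δ X).toReal * p j g g' X = ∑ j, ∑ X, (Δ X).toReal * p j g' g X := by
    refine Finset.sum_congr rfl fun j _ => ?_
    rw [← hΔ.sum_comp_perm (σ j) (p j g g')]
    refine Finset.sum_congr rfl fun X _ => ?_
    simp only [p, Function.comp_apply,
      doubledAnswer_apply_perm S (σ j) f g g' (hinv j) (hS j) (hfix j)]
  have h1 := abs_le.1 (hhybrid g g')
  have h2 := abs_le.1 (hhybrid g' g)
  rw [mul_sub]
  linarith [h1.2, h2.1]

end QueryAlgorithm

end RandomInput

/-! ### The lower bound -/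

theorem theorem2 (ε : ℝ) (hε : 0 < ε) :
    ∃ C : ℝ, 0 < C ∧
      ∀ (D R : Type*) [Fintype D]
        (F : Set (D → R)) (_hF : F.Finite)
        (P : F → Bool) (_hP : Function.Surjective P)
        (d : ℕ) (S : Finset D) (_hind : RandomInput.IsIndependentProperty F P d S)
        (N : ℕ) (Δ : PMF (Fin N → D)) (_hΔ : RandomInput.IsPermutationIndependent Δ)
        (A B W : Type*) [Fintype A] [Fintype B] [Fintype W]
        [DecidableEq A] [DecidableEq B] [DecidableEq W]
        (Q : RandomInput.QueryAlgorithm N D R A B W)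
        (_hQ : Q.ComputesWithBias F P Δ ε),
        (S = ∅ → ((d : ℝ) + 1) / 2 ≤ (Q.numQueries : ℝ)) ∧
        (S.Nonempty →
          min (((d : ℝ) + 1) / 2) (C * Real.sqrt ((Fintype.card D : ℝ) / (S.card : ℝ)))
            ≤ (Q.numQueries : ℝ)) := by
  classical
  -- `1 / 2` handles `n < 2|S|`, where no disjoint copy of `S` fits; `ε / 8` comes from `q ≥ εr/4`
  -- and `√(n/|S|) ≤ 2r` in the other case.
  refine ⟨min (ε / 8) (1 / 2), by positivity, ?_⟩
  intro D R _ F hF P hP d S hind N Δ hΔ A B W _ _ _ _ _ _ Q hQ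
  have : Fintype F := hF.fintype
  have hfew : (Q.numQueries : ℝ) < ((d : ℝ) + 1) / 2 → 2 * Q.numQueries ≤ d := by
    intro h
    have : ((2 * Q.numQueries : ℕ) : ℝ) < (d + 1 : ℕ) := by push_cast; linarith
    exact Nat.lt_succ_iff.1 (Nat.cast_lt.1 this)
  constructor
  · rintro rfl
    by_contra! hlt
    have := hQ.two_mul_le hP hind (c := 0) (hfew hlt) fun f g g' => by simp
    linarith
  · intro hS
    by_contra! hlt
    obtain ⟨hlt₁, hlt₂⟩ := lt_min_iff.1 hlt
    have hd := hfew hlt₁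
    have hk : (0 : ℝ) < S.card := Nat.cast_pos.2 hS.card_pos
    rcases lt_or_ge (Fintype.card D) (2 * S.card) with hn | hn
    · have hratio : √((Fintype.card D : ℝ) / S.card) ≤ 2 := by
        refine Real.sqrt_le_iff.2 ⟨zero_le_two, (div_le_iff₀ hk).2 ?_⟩
        have : (Fintype.card D : ℝ) < 2 * S.card := by exact_mod_cast hn
        linarith
      have hlt₃ : (Q.numQueries : ℝ) < 1 := by
        refine hlt₂.trans_le ?_
        calc _ ≤ (1 / 2 : ℝ) * 2 :=
              mul_le_mul (min_le_right _ _) hratio (Real.sqrt_nonneg _) (by norm_num)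
          _ = 1 := by norm_num
      have hzero : Q.numQueries = 0 := Nat.lt_one_iff.1 (by exact_mod_cast hlt₃)
      -- Without queries the output cannot depend on the input function at all.
      have := hQ.two_mul_le hP hind (c := 0) hd fun f g g' => by
        simp [RandomInput.QueryAlgorithm.acceptProb, RandomInput.QueryAlgorithm.outputProb, hzero,
          RandomInput.QueryAlgorithm.state]
      linarith
    · obtain ⟨m, hm⟩ : ∃ m, Fintype.card D / S.card = m + 1 + 1 :=
        Nat.exists_eq_add_of_le' ((Nat.le_div_iff_mul_le hS.card_pos).2 hn)
      have hfit : S.card * (m + 1 + 1) ≤ Fintype.card D := hm ▸ Nat.mul_div_le _ _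
      have hratio : (Fintype.card D : ℝ) / S.card < m + 3 := by
        rw [div_lt_iff₀ hk]
        have := Nat.lt_mul_of_div_lt (hm.trans_lt (Nat.lt_succ_self _)) hS.card_pos
        have : (Fintype.card D : ℝ) < ((m + 1 + 1 + 1) * S.card : ℕ) := by
          exact_mod_cast this
        push_cast at this
        linarith
      set r : ℝ := √((m + 1 : ℕ) : ℝ) with hr
      have hrpos : 0 < r := Real.sqrt_pos.2 (by positivity)
      have hrsq : r * r = m + 1 := by rw [hr, Real.mul_self_sqrt (by positivity)]; push_cast; rfl
      have hbias := hQ.two_mul_le hP hind (c := 8 * Q.numQueries / r) hd fun f g g' => by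
        have := Q.mul_acceptProb_sub_le hΔ S (m + 1) hfit f g g'
        rw [← hr] at this
        push_cast at this
        rw [← hrsq] at this
        rw [le_div_iff₀ hrpos]
        refine le_of_mul_le_mul_right ?_ hrpos
        linarith
      rw [le_div_iff₀ hrpos] at hbias
      -- Here `n/|S| < m + 3 ≤ 4 (m + 1) = (2r)²`.
      have hupper : √((Fintype.card D : ℝ) / S.card) ≤ 2 * r := by
        refine Real.sqrt_le_iff.2 ⟨by positivity, ?_⟩
        have hm0 : (0 : ℝ) ≤ m := Nat.cast_nonneg m
        nlinarith
      have : (Q.numQueries : ℝ) < ε / 8 * (2 * r) :=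
        hlt₂.trans_le (mul_le_mul (min_le_left _ _) hupper (Real.sqrt_nonneg _) (by positivity))
      linarith
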